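/- Let $k$ be a field of characteristic different from $2$ and $3$ with algebraic closure $\overline{k}$, and let $a,d\in k$ be distinct and non-zero. Let $E$ be the twisted Edwards curve $ax^2+y^2=1+dx^2y^2$, with the addition \[(x_1,y_1)+(x_2,y_2)=\left(\frac{x_1y_2+x_2y_1}{1+dx_1x_2y_1y_2},\ \frac{y_1y_2-ax_1x_2}{1-dx_1x_2y_1y_2}\right)\] and identity $(0,1)$. Where a denominator vanishes, or a point at infinity is involved, addition is understood on the closure of $E$ in $\mathbb{P}^1\times\mathbb{P}^1$: with $x=X/Z$, $y=Y/T$ it is given by this rule in homogeneous coordinates whenever that yields a point, and otherwise by the form \[\left(\frac{x_1y_1+x_2y_2}{ax_1x_2+y_1y_2},\ \frac{x_1y_1-x_2y_2}{x_1y_2-x_2y_1}\right)\] in homogeneous coordinates, which agrees with it wherever both yield a point. Let $[n]P$ denote the $n$-fold sum of $P$ in this group. Define rational functions $\psi_n$ on $E$ for $n\ge 0$ by \begin{align*} \psi_0&=0,\qquad \psi_1=1,\qquad \psi_2=\frac{(a-d)(1+y)}{x\,(2(1-y))},\\ \psi_3&=\frac{(a-d)^3(a+2ay-2dy^3-dy^4)}{(2(1-y))^4},\qquad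 \psi_4=\frac{2(a-d)^6\,y(1+y)(a-dy^4)}{x\,(2(1-y))^7},\\ \psi_{2m+1}&=\psi_{m+2}\psi_m^3-\psi_{m-1}\psi_{m+1}^3\quad (m\ge 2),\\ \psi_{2m}&=\frac{\psi_m}{\psi_2}\left(\psi_{m+2}\psi_{m-1}^2-\psi_{m-2}\psi_{m+1}^2\right)\quad (m\ge 3). \end{align*} Then for every point $P=(x,y)\in E(\overline{k})\setminus\{(0,1),(0,-1)\}$ and every integer $n\ge 1$, $P$ is an $n$-torsion point of $E$, that is $[n]P=(0,1)$, if and only if $\psi_n(P)=0$. -/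

import Mathlib

/-!
# Twisted Edwards curves `a x² + y² = 1 + d x² y²` over a field

The rule
`(x₁, y₁) + (x₂, y₂) = ((x₁y₂ + x₂y₁)/(1 + d x₁x₂y₁y₂), (y₁y₂ - a x₁x₂)/(1 - d x₁x₂y₁y₂))`
can have a vanishing denominator over an algebraically closed field, and a multiple of an affine
point can be one of the four points of the smooth complete curve which lie at infinity.  We
therefore work on the complete curve, the closure of the affine curve in `ℙ¹ × ℙ¹`.  There the
group law is the rule above, written in homogeneous coordinates, and its continuous extension
to the pairs of points at which the homogeneous rule degenerates to `0/0`.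
-/

namespace TwistedEdwards

/-- The affine equation of the twisted Edwards curve with coefficients `a` and `d`. -/
def OnCurve {F : Type*} [Field F] (a d x y : F) : Prop :=
  a * x ^ 2 + y ^ 2 = 1 + d * x ^ 2 * y ^ 2

/-- Homogeneous coordinates `((X : Z), (Y : T))` on `ℙ¹ × ℙ¹`, where `x = X / Z`, `y = Y / T`. -/
@[ext]
structure Coords (F : Type*) where
  X : F
  Z : F
  Y : F
  T : F

namespace Coords

variable {F : Type*} [Field F]

/-- The coordinates do define a point of `ℙ¹ × ℙ¹`. -/
def Nondegenerate (P : Coords F) : Prop :=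
  (P.X ≠ 0 ∨ P.Z ≠ 0) ∧ (P.Y ≠ 0 ∨ P.T ≠ 0)

/-- The coordinates define a point of the closure in `ℙ¹ × ℙ¹` of the twisted Edwards curve. -/
def OnCompleteCurve (a d : F) (P : Coords F) : Prop :=
  P.Nondegenerate ∧
    a * P.X ^ 2 * P.T ^ 2 + P.Y ^ 2 * P.Z ^ 2 = P.Z ^ 2 * P.T ^ 2 + d * P.X ^ 2 * P.Y ^ 2

/-- Equality of points of `ℙ¹ × ℙ¹`: both pairs of coordinates agree up to a nonzero scalar. -/
def SamePoint (P Q : Coords F) : Prop :=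
  (∃ c : F, c ≠ 0 ∧ Q.X = c * P.X ∧ Q.Z = c * P.Z) ∧
    ∃ c : F, c ≠ 0 ∧ Q.Y = c * P.Y ∧ Q.T = c * P.T

/-- The point of `ℙ¹ × ℙ¹` given by the affine point `(x, y)`. -/
def ofAffine (x y : F) : Coords F := ⟨x, 1, y, 1⟩

/-- The identity `(0, 1)`. -/
def zero : Coords F := ofAffine 0 1

/-- The Edwards addition rule
`((x₁y₂ + x₂y₁)/(1 + d x₁x₂y₁y₂), (y₁y₂ - a x₁x₂)/(1 - d x₁x₂y₁y₂))`,
in homogeneous coordinates. -/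
def addEdwards (a d : F) (P Q : Coords F) : Coords F where
  X := P.X * Q.Y * Q.Z * P.T + Q.X * P.Y * P.Z * Q.T
  Z := P.Z * Q.Z * P.T * Q.T + d * P.X * Q.X * P.Y * Q.Y
  Y := P.Y * Q.Y * P.Z * Q.Z - a * P.X * Q.X * P.T * Q.T
  T := P.Z * Q.Z * P.T * Q.T - d * P.X * Q.X * P.Y * Q.Y

/-- The dual form of the Edwards addition rule,
`((x₁y₁ + x₂y₂)/(a x₁x₂ + y₁y₂), (x₁y₁ - x₂y₂)/(x₁y₂ - x₂y₁))`, in homogeneous coordinates.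
On the curve it agrees with `addEdwards` wherever both define a point. -/
def addDual (a : F) (P Q : Coords F) : Coords F where
  X := P.X * P.Y * Q.Z * Q.T + Q.X * Q.Y * P.Z * P.T
  Z := a * P.X * Q.X * P.T * Q.T + P.Y * Q.Y * P.Z * Q.Z
  Y := P.X * P.Y * Q.Z * Q.T - Q.X * Q.Y * P.Z * P.T
  T := P.X * Q.Y * Q.Z * P.T - Q.X * P.Y * P.Z * Q.T

open Classical in
/-- The addition of the complete twisted Edwards curve. -/
noncomputable def add (a d : F) (P Q : Coords F) : Coords F :=
  if (addEdwards a d P Q).Nondegenerate then addEdwards a d P Q else addDual a P Q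

/-- The multiple `[n]P = P + ⋯ + P`. -/
noncomputable def nsmul (a d : F) : ℕ → Coords F → Coords F
  | 0, _ => zero
  | n + 1, P => add a d (nsmul a d n P) P

/-- Where the affine Edwards rule makes sense, it computes the sum. -/
theorem add_ofAffine (a d x₁ y₁ x₂ y₂ : F) (hp : 1 + d * x₁ * x₂ * y₁ * y₂ ≠ 0)
    (hm : 1 - d * x₁ * x₂ * y₁ * y₂ ≠ 0) :
    SamePoint (add a d (ofAffine x₁ y₁) (ofAffine x₂ y₂))
      (ofAffine ((x₁ * y₂ + x₂ * y₁) / (1 + d * x₁ * x₂ * y₁ * y₂))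
        ((y₁ * y₂ - a * x₁ * x₂) / (1 - d * x₁ * x₂ * y₁ * y₂))) := by
  have h : (addEdwards a d (ofAffine x₁ y₁) (ofAffine x₂ y₂)).Nondegenerate := by
    refine ⟨Or.inr ?_, Or.inr ?_⟩ <;> simpa [addEdwards, ofAffine]
  rw [add, if_pos h]
  refine ⟨⟨_, inv_ne_zero hp, ?_, ?_⟩, ⟨_, inv_ne_zero hm, ?_, ?_⟩⟩ <;>
    simp [addEdwards, ofAffine] <;> field_simp

/-- At every pair of points of the complete curve, at least one of the two rules defines a
point, so the addition is total. -/
theorem add_nondegenerate {a d : F} (h2 : (2 : F) ≠ 0) (ha : a ≠ 0) (hd : d ≠ 0) (had : a ≠ d)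
    {P Q : Coords F} (hP : P.OnCompleteCurve a d) (hQ : Q.OnCompleteCurve a d) :
    (add a d P Q).Nondegenerate := by
  by_cases h : (addEdwards a d P Q).Nondegenerate
  · rwa [add, if_pos h]
  rw [add, if_neg h]
  obtain ⟨X, Z, Y, T⟩ := P
  obtain ⟨U, W, V, S⟩ := Q
  obtain ⟨⟨p1, p2⟩, p⟩ := hP
  obtain ⟨⟨q1, q2⟩, q⟩ := hQ
  simp only [Nondegenerate, addEdwards, addDual] at *
  rw [not_and_or, not_or, not_or, not_not, not_not, not_not, not_not] at h
  by_contra h'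
  rw [not_and_or, not_or, not_or, not_not, not_not, not_not, not_not] at h'
  rcases h with h | h <;> rcases h' with h' | h' <;>
    by_cases hZ : Z = 0 <;> by_cases hT : T = 0 <;> by_cases hW : W = 0 <;>
    by_cases hS : S = 0 <;> grind

/-- The complete curve is closed under addition. -/
theorem add_onCompleteCurve {a d : F} (h2 : (2 : F) ≠ 0) (ha : a ≠ 0) (hd : d ≠ 0) (had : a ≠ d)
    {P Q : Coords F} (hP : P.OnCompleteCurve a d) (hQ : Q.OnCompleteCurve a d) :
    (add a d P Q).OnCompleteCurve a d := by
  refine ⟨add_nondegenerate h2 ha hd had hP hQ, ?_⟩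
  have p := hP.2
  have q := hQ.2
  by_cases h : (addEdwards a d P Q).Nondegenerate
  · rw [add, if_pos h]
    simp only [addEdwards]
    grind
  · rw [add, if_neg h]
    simp only [addDual]
    grind

/-- Two pairs of homogeneous coordinates with equal cross products are proportional. -/
theorem exists_scalar {x z x' z' : F} (h : x ≠ 0 ∨ z ≠ 0) (h' : x' ≠ 0 ∨ z' ≠ 0)
    (e : x * z' = x' * z) : ∃ c : F, c ≠ 0 ∧ x' = c * x ∧ z' = c * z := by
  by_cases hx : x = 0
  · have hz : z ≠ 0 := by tauto
    have hx' : x' = 0 := by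
      rw [hx, zero_mul] at e
      exact (mul_eq_zero.1 e.symm).resolve_right hz
    have hz' : z' ≠ 0 := by tauto
    exact ⟨z' / z, div_ne_zero hz' hz, by rw [hx, hx', mul_zero], by field_simp⟩
  · have hx' : x' ≠ 0 := by
      rintro rfl
      rw [zero_mul] at e
      have := (mul_eq_zero.1 e).resolve_left hx
      tauto
    refine ⟨x' / x, div_ne_zero hx' hx, by field_simp, ?_⟩
    field_simp
    linear_combination e

/-- The two rules agree where both define a point. -/
theorem samePoint_addEdwards_addDual {a d : F} {P Q : Coords F}
    (hP : P.OnCompleteCurve a d) (hQ : Q.OnCompleteCurve a d)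
    (h : (addEdwards a d P Q).Nondegenerate) (h' : (addDual a P Q).Nondegenerate) :
    SamePoint (addEdwards a d P Q) (addDual a P Q) := by
  have p := hP.2
  have q := hQ.2
  refine ⟨exists_scalar h.1 h'.1 ?_, exists_scalar h.2 h'.2 ?_⟩ <;>
    simp only [addEdwards, addDual] <;> grind

end Coords

/-- The point `(x, y)` is an `n`-torsion point: `[n](x, y)` is the identity `(0, 1)`. -/
def IsTorsionPoint {F : Type*} [Field F] (a d x y : F) (n : ℕ) : Prop :=
  Coords.SamePoint (Coords.nsmul a d n (Coords.ofAffine x y)) Coords.zero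

/-- The rational functions `ψ_n(x, y)`.  For `n ≥ 5` the two branches are the recursions for
`n = 2m + 1` with `m = j + 2` and for `n = 2m` with `m = j + 3`, where `j = (n - 5) / 2`; see
`psi_odd` and `psi_even`. -/
def psi {F : Type*} [Field F] (a d x y : F) : ℕ → F
  | 0 => 0
  | 1 => 1
  | 2 => (a - d) * (1 + y) / (x * (2 * (1 - y)))
  | 3 => (a - d) ^ 3 * (a + 2 * a * y - 2 * d * y ^ 3 - d * y ^ 4) / (2 * (1 - y)) ^ 4
  | 4 => 2 * (a - d) ^ 6 * y * (1 + y) * (a - d * y ^ 4) / (x * (2 * (1 - y)) ^ 7)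
  | n + 5 =>
    if n % 2 = 0 then
      psi a d x y (n / 2 + 4) * psi a d x y (n / 2 + 2) ^ 3 -
        psi a d x y (n / 2 + 1) * psi a d x y (n / 2 + 3) ^ 3
    else
      psi a d x y (n / 2 + 3) / ((a - d) * (1 + y) / (x * (2 * (1 - y)))) *
        (psi a d x y (n / 2 + 5) * psi a d x y (n / 2 + 2) ^ 2 -
          psi a d x y (n / 2 + 1) * psi a d x y (n / 2 + 4) ^ 2)
  decreasing_by all_goals omega

section

variable {F : Type*} [Field F] (a d x y : F)

theorem psi_two : psi a d x y 2 = (a - d) * (1 + y) / (x * (2 * (1 - y))) := by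
  rw [psi]

theorem psi_odd (m : ℕ) (hm : 2 ≤ m) :
    psi a d x y (2 * m + 1) =
      psi a d x y (m + 2) * psi a d x y m ^ 3 -
        psi a d x y (m - 1) * psi a d x y (m + 1) ^ 3 := by
  obtain ⟨j, rfl⟩ := Nat.exists_eq_add_of_le hm
  have h : 2 * (2 + j) + 1 = 2 * j + 5 := by ring
  have h0 : 2 * j % 2 = 0 := by omega
  have h1 : 2 * j / 2 = j := by omega
  have h3 : 2 + j - 1 = j + 1 := by omega
  rw [h, psi, if_pos h0, h1, h3, show 2 + j + 2 = j + 4 by ring, show 2 + j = j + 2 by ring]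

theorem psi_even (m : ℕ) (hm : 3 ≤ m) :
    psi a d x y (2 * m) =
      psi a d x y m / psi a d x y 2 *
        (psi a d x y (m + 2) * psi a d x y (m - 1) ^ 2 -
          psi a d x y (m - 2) * psi a d x y (m + 1) ^ 2) := by
  obtain ⟨j, rfl⟩ := Nat.exists_eq_add_of_le hm
  have h : 2 * (3 + j) = (2 * j + 1) + 5 := by ring
  have h0 : ¬ (2 * j + 1) % 2 = 0 := by omega
  have h1 : (2 * j + 1) / 2 = j := by omega
  have h3 : 3 + j - 1 = j + 2 := by omega
  have h4 : 3 + j - 2 = j + 1 := by omega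
  rw [h, psi_two, psi, if_neg h0, h1, h3, h4, show 3 + j + 2 = j + 5 by ring,
    show 3 + j + 1 = j + 4 by ring, show 3 + j = j + 3 by ring]

/-- At a point of the curve other than `(0, 1)` and `(0, -1)`, no denominator in the definition
of `psi` vanishes, so that `psi a d x y n` is the value at `(x, y)` of the rational function
given by these formulas. -/
theorem denominators_ne_zero {a d x y : F} (h2 : (2 : F) ≠ 0) (had : a ≠ d)
    (h : OnCurve a d x y) (h1 : (x, y) ≠ (0, 1)) (h1' : (x, y) ≠ (0, -1)) :
    x ≠ 0 ∧ 2 * (1 - y) ≠ 0 ∧ psi a d x y 2 ≠ 0 := by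
  have hx : x ≠ 0 := by
    rintro rfl
    have : (y - 1) * (y + 1) = 0 := by unfold OnCurve at h; linear_combination h
    rcases mul_eq_zero.1 this with h | h
    · exact h1 (by rw [sub_eq_zero.1 h])
    · exact h1' (by rw [eq_neg_of_add_eq_zero_left h])
  have hy : y ^ 2 ≠ 1 := by
    intro hy
    have : (a - d) * x ^ 2 = 0 := by
      unfold OnCurve at h; rw [hy] at h; linear_combination h
    exact mul_ne_zero (sub_ne_zero.2 had) (pow_ne_zero 2 hx) this
  have hm : 1 - y ≠ 0 := fun h => hy (by rw [← sub_eq_zero.1 h]; ring)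
  have hp : 1 + y ≠ 0 := fun h => hy (by rw [eq_neg_of_add_eq_zero_right h]; ring)
  refine ⟨hx, mul_ne_zero h2 hm, ?_⟩
  rw [psi_two]
  exact div_ne_zero (mul_ne_zero (sub_ne_zero.2 had) hp) (mul_ne_zero hx (mul_ne_zero h2 hm))

end

end TwistedEdwards

/-!
The `y`-coordinate of the complete curve is an even function of degree two which takes the value
`1` only at the identity, so `[n]P = 0` if and only if `y([n]P) = 1`. For three consecutive
multiples `S`, `Q = S + P`, `R = Q + P`, the symmetric functions of `y(R)` and `y(S) = y(Q - P)` are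
biquadratic forms in `y(P)` and `y(Q)` (`Coords.exists_scalar_consecutive`).

With `u = (a - d)(1 + y) / (4(1 - y))`, the curve becomes the Weierstrass curve
`v² = u³ + A u² + B u`, and `psi` is the elliptic divisibility sequence of its division polynomials
(`psi_eq_normEDS`, `psi_weierstrass`). The biquadratic relations turn into identities for the pairs
`(Φₙ, ψₙ²)`, where `Φₙ = u ψₙ² - ψₙ₊₁ψₙ₋₁` (`ladderNum_relations`). These identities amount to the
Somos-4 relation and the constancy of Ward's invariant (`normEDS_somos_four`,
`normEDS_invariant`), which are consequences of the recursions defining the sequence: the odd and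
even relations imply all elliptic relations (`IsEllipticNet.atomRel_eq_zero`).

Since a product of two linear forms determines one factor once the other, nonzero, one is known,
induction shows that `(Φₙ, ψₙ²)` is nonzero and represents the point `u([n]P)` of `ℙ¹`
(`exists_scalar_nsmul`). No separate argument is needed for the multiples that are the identity, and
`ψₙ² = 0` says exactly that `u([n]P) = ∞`, that is `y([n]P) = 1`.
-/

/-! ### Elliptic divisibility sequences -/

namespace IsEllipticNet

variable {R : Type*} [CommRing R] {W : ℤ → R}

/-- For fixed `e` and `f`, the relators `ERₐ(x, y, e, f)` measure the failure of the skew form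
`(x, y) ↦ Wₐ(x, y)` to have rank two, so they generate all relators up to powers of `Wₐ(e, f)`. -/
lemma atomRel_eq_zero_of_pairs [IsDomain R] {a b c d e f : ℤ} (hef : atom W e f ≠ 0)
    (hab : atomRel W a b e f = 0) (hac : atomRel W a c e f = 0) (had : atomRel W a d e f = 0)
    (hbc : atomRel W b c e f = 0) (hbd : atomRel W b d e f = 0) (hcd : atomRel W c d e f = 0) :
    atomRel W a b c d = 0 := by
  refine (mul_eq_zero.1 ?_).resolve_left (pow_ne_zero 2 hef)
  simp only [atomRel] at *
  linear_combination
    (atom W c d * atom W e f) * hab - (atom W b d * atom W e f) * hac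
      + (atom W b c * atom W e f) * had
      + (atom W a e * atom W d f - atom W a f * atom W d e) * hbc
      - (atom W a e * atom W c f - atom W a f * atom W c e) * hbd
      + (atom W a e * atom W b f - atom W a f * atom W b e) * hcd

/-- A sequence satisfying the odd and even relations satisfies the relations between all sorted
quadruples of indices of the same parity. The involution `atomRel_avg_sub` lowers the largest index
unless `a ≤ b + c - d`; in that case `atomRel_eq_zero_of_pairs` reduces to `(c, d) = (2, 0)` or
`(c, d) = (3, 1)`, where only `b = a - 2` resists the involution, and this is the odd or the even
relation. -/
theorem atomRel_eq_zero [IsDomain R] (odd : W.Odd) (h0 : W 0 = 0) (h1 : W 1 ≠ 0) (h2 : W 2 ≠ 0)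
    (hodd : ∀ m, rel W (m + 1) m 1 0 = 0) (heven : ∀ m, rel W (m + 1) (m - 1) 1 0 = 0)
    {a b c d : ℤ} (hd : 0 ≤ d) (hcd : d < c) (hbc : c < b) (hab : b < a)
    (parity : d % 2 = a % 2 ∧ d % 2 = b % 2 ∧ d % 2 = c % 2) : atomRel W a b c d = 0 := by
  obtain ⟨N, hN⟩ : ∃ N : ℕ, a < N := ⟨a.toNat + 1, by omega⟩
  induction N generalizing a b c d with
  | zero => omega
  | succ N ih =>
    -- the involution lowers the largest index
    have key : ∀ {b c d : ℤ}, 0 ≤ d → d < c → c < b → b < a →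
        (d % 2 = a % 2 ∧ d % 2 = b % 2 ∧ d % 2 = c % 2) → b + c - d < a →
        atomRel W a b c d = 0 := by
      intro b c d hd hcd hbc hab parity h
      rw [← atomRel_avg_sub W parity, ← atomRel_abs₄]
      apply ih <;> grind
    have pair : ∀ {x : ℤ} (e : ℤ), (e = 0 ∨ e = 1) → e % 2 = a % 2 → e % 2 = x % 2 →
        e ≤ x → x < a → atomRel W a x (e + 2) e = 0 := by
      intro x e he hea hex hx hxa
      obtain rfl | rfl | hx' : x = e ∨ x = e + 2 ∨ e + 2 < x := by omega
      · simp [atomRel_same₂₄ odd, h0]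
      · simp [h0]
      obtain h | h : x + 2 < a ∨ a = x + 2 := by omega
      · exact key (by omega) (by omega) hx' hxa ⟨hea, hex, by omega⟩ (by omega)
      obtain rfl | rfl := he
      · obtain ⟨m, rfl⟩ : ∃ m, x = 2 * m := ⟨x / 2, by omega⟩
        have := hodd m
        rw [rel_eq] at this
        convert this using 2 <;> omega
      · obtain ⟨m, rfl⟩ : ∃ m, x = 2 * m - 1 := ⟨(x + 1) / 2, by omega⟩
        have := heven m
        rw [rel_eq, ← atomRel_avg_sub W (by omega), ← atomRel_neg₄] at this
        convert this using 2 <;> omega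
    have pair' : ∀ {x y : ℤ} (e : ℤ), (e = 0 ∨ e = 1) → e % 2 = x % 2 → e % 2 = y % 2 →
        e ≤ y → y < x → x < a → atomRel W x y (e + 2) e = 0 := by
      intro x y e he hex hey hy hyx hxa
      obtain rfl | rfl | hy' : y = e ∨ y = e + 2 ∨ e + 2 < y := by omega
      · simp [atomRel_same₂₄ odd, h0]
      · simp [h0]
      · exact ih (by omega) (by omega) hy' hyx ⟨hex, hey, by omega⟩ (by omega)
    obtain ⟨e, he, hed⟩ : ∃ e : ℤ, (e = 0 ∨ e = 1) ∧ e % 2 = d % 2 := ⟨d % 2, by omega⟩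
    have hatom : atom W (e + 2) e ≠ 0 := by
      obtain rfl | rfl := he
      · simpa [atom] using h1
      · simpa [atom] using ⟨h2, h1⟩
    apply atomRel_eq_zero_of_pairs hatom
    · exact pair e he (by omega) (by omega) (by omega) (by omega)
    · exact pair e he (by omega) (by omega) (by omega) (by omega)
    · exact pair e he (by omega) (by omega) (by omega) (by omega)
    · exact pair' e he (by omega) (by omega) (by omega) (by omega) (by omega)
    · exact pair' e he (by omega) (by omega) (by omega) (by omega) (by omega)
    · exact pair' e he (by omega) (by omega) (by omega) (by omega) (by omega)

end IsEllipticNet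

section NormEDS

variable {R : Type*} [CommRing R]

lemma normEDS_atomRel_eq_zero [IsDomain R] {b c d : R} (hb : b ≠ 0) {p q r s : ℤ}
    (hs : 0 ≤ s) (hrs : s < r) (hqr : r < q) (hpq : q < p)
    (parity : s % 2 = p % 2 ∧ s % 2 = q % 2 ∧ s % 2 = r % 2) :
    IsEllipticNet.atomRel (normEDS b c d) p q r s = 0 := by
  refine IsEllipticNet.atomRel_eq_zero (normEDS_neg b c d) (by simp) (by simp) (by simpa)
    (fun m ↦ ?_) (fun m ↦ ?_) hs hrs hqr hpq parity
  · rw [IsEllipticNet.rel_odd, normEDS_odd, normEDS_one]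
    ring
  · rw [IsEllipticNet.rel_even, normEDS_two, normEDS_one]
    linear_combination normEDS_even b c d m

/-- The relation `ER(n, 2, 1, 0) = 0`, a Somos-4 recurrence. -/
lemma normEDS_somos_four [IsDomain R] {b c d : R} (hb : b ≠ 0) {n : ℤ} (hn : 0 ≤ n) :
    normEDS b c d (n + 2) * normEDS b c d (n - 2) =
      b ^ 2 * normEDS b c d (n + 1) * normEDS b c d (n - 1) - c * normEDS b c d n ^ 2 := by
  obtain rfl | rfl | rfl | hn : n = 0 ∨ n = 1 ∨ n = 2 ∨ 2 < n := by omega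
  · simp [normEDS_neg]
    ring
  · norm_num [normEDS_neg]
  · norm_num
    ring
  · have h : IsEllipticNet.rel (normEDS b c d) n 2 1 0 = 0 := by
      rw [IsEllipticNet.rel_eq]
      exact normEDS_atomRel_eq_zero hb (by omega) (by omega) (by omega) (by omega) (by omega)
    norm_num [IsEllipticNet.rel] at h
    linear_combination h

/-- The relation `ER(n, 2, 1, 1) = 0`, a Somos-5 recurrence. -/
lemma normEDS_somos_five [IsDomain R] {b c d : R} (hb : b ≠ 0) {n : ℤ} (hn : 1 ≤ n) :
    b * normEDS b c d (n + 3) * normEDS b c d (n - 2) =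
      b * c * normEDS b c d (n + 2) * normEDS b c d (n - 1)
        - d * b * normEDS b c d (n + 1) * normEDS b c d n := by
  obtain rfl | rfl | hn : n = 1 ∨ n = 2 ∨ 2 < n := by omega
  · norm_num [normEDS_neg]
    ring
  · norm_num
    ring
  · have h : IsEllipticNet.rel (normEDS b c d) n 2 1 1 = 0 := by
      rw [IsEllipticNet.rel_eq]
      exact normEDS_atomRel_eq_zero hb (by omega) (by omega) (by omega) (by omega) (by omega)
    norm_num [IsEllipticNet.rel, add_assoc] at h
    linear_combination h

lemma normEDS_invariant_of_isDomain [IsDomain R] {b c d K : R} (h2 : (2 : R) ≠ 0) (hb : b ≠ 0)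
    (hc : c ≠ 0) (h : d + b ^ 4 = K * c) {n : ℤ} (hn : 1 ≤ n) :
    normEDS b c d (n + 2) * normEDS b c d (n - 1) ^ 2 +
        normEDS b c d (n - 2) * normEDS b c d (n + 1) ^ 2 + b ^ 2 * normEDS b c d n ^ 3 =
      K * normEDS b c d (n + 1) * normEDS b c d n * normEDS b c d (n - 1) := by
  obtain rfl | hn' : n = 1 ∨ 2 ≤ n := by omega
  · norm_num [normEDS_neg]
  have e1 := normEDS_somos_four (c := c) (d := d) hb (n := n - 1) (by omega)
  have e2 := normEDS_somos_four (c := c) (d := d) hb (n := n) (by omega)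
  have e3 := normEDS_somos_four (c := c) (d := d) hb (n := n + 1) (by omega)
  have e4 := normEDS_somos_five (c := c) (d := d) hb (n := n - 1) (by omega)
  have e5 := normEDS_somos_five (c := c) (d := d) hb (n := n) (by omega)
  rw [show n - 1 + 2 = n + 1 by ring, show n - 1 - 2 = n - 3 by ring,
    show n - 1 + 1 = n by ring, show n - 1 - 1 = n - 2 by ring] at e1 e4
  rw [show n - 1 + 3 = n + 2 by ring] at e4
  rw [show n + 1 + 2 = n + 3 by ring, show n + 1 - 2 = n - 1 by ring,
    show n + 1 + 1 = n + 2 by ring, show n + 1 - 1 = n by ring] at e3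
  refine mul_left_cancel₀ (mul_ne_zero (mul_ne_zero h2 hb) hc) ?_
  set W := normEDS b c d
  linear_combination W (n - 1) * (-e5) + W (n + 1) * (-e4) + b * W (n - 2) * e3
    + b * W (n + 2) * e1 + 2 * b ^ 3 * W n * e2 + 2 * b * W (n + 1) * W n * W (n - 1) * h

/-- Ward's invariant of an elliptic divisibility sequence: the quotient of the left side by
`W(n + 1)W(n)W(n - 1)` does not depend on `n`. For `n = 2` it is `(d + b⁴) / c`, and the hypothesis
`h` says that it is `K`. Since `b` and `c` may be zero divisors, the identity is proved for
indeterminates `b`, `c`, `K` and specialized. -/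
theorem normEDS_invariant {b c d K : R} (h : d + b ^ 4 = K * c) {n : ℤ} (hn : 1 ≤ n) :
    normEDS b c d (n + 2) * normEDS b c d (n - 1) ^ 2 +
        normEDS b c d (n - 2) * normEDS b c d (n + 1) ^ 2 + b ^ 2 * normEDS b c d n ^ 3 =
      K * normEDS b c d (n + 1) * normEDS b c d n * normEDS b c d (n - 1) := by
  let X : Fin 3 → MvPolynomial (Fin 3) ℤ := MvPolynomial.X
  have key := normEDS_invariant_of_isDomain (b := X 0) (c := X 1) (d := X 2 * X 1 - X 0 ^ 4)
    (K := X 2) two_ne_zero (MvPolynomial.X_ne_zero 0) (MvPolynomial.X_ne_zero 1) (by ring) hn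
  have := congrArg (MvPolynomial.aeval ![b, c, K]) key
  simpa [map_normEDS, X, ← h] using this

end NormEDS

/-! ### The `x`-coordinates of multiples in terms of the sequence -/

section Ladder

variable {R : Type*} [CommRing R]

/-- The numerator `Φₙ` of the `x`-coordinate `Φₙ / Wₙ²` of `nP`, where `W = normEDS b c d` is the
sequence of division polynomials evaluated at a point `P` with `x`-coordinate `u`. -/
def ladderNum (u b c d : R) (n : ℤ) : R :=
  u * normEDS b c d n ^ 2 - normEDS b c d (n + 1) * normEDS b c d (n - 1)

/-- On the curve `v² = u³ + A u² + B u`, the sum and the product of the `x`-coordinates of `Q + P`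
and `Q - P` are given by biquadratic forms in the `x`-coordinates of `P` and `Q`. The pairs
`(Φₙ, Wₙ²)` satisfy these relations for `P` and `Q = nP`, even where they vanish. -/
theorem ladderNum_relations [IsDomain R] {u A B b c d : R} (hb : b ≠ 0)
    (hb2 : b ^ 2 = 4 * (u ^ 3 + A * u ^ 2 + B * u))
    (hc : c = 3 * u ^ 4 + 4 * A * u ^ 3 + 6 * B * u ^ 2 - B ^ 2)
    (hd : d + b ^ 4 = (6 * u ^ 2 + 4 * A * u + 2 * B) * c) {n : ℤ} (hn : 1 ≤ n) :
    normEDS b c d (n + 1) ^ 2 * normEDS b c d (n - 1) ^ 2 =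
        (u * normEDS b c d n ^ 2 - ladderNum u b c d n) ^ 2 ∧
      ladderNum u b c d (n + 1) * normEDS b c d (n - 1) ^ 2 +
          normEDS b c d (n + 1) ^ 2 * ladderNum u b c d (n - 1) =
        2 * (ladderNum u b c d n + u * normEDS b c d n ^ 2) *
            (u * ladderNum u b c d n + B * normEDS b c d n ^ 2) +
          4 * A * u * ladderNum u b c d n * normEDS b c d n ^ 2 ∧
      ladderNum u b c d (n + 1) * ladderNum u b c d (n - 1) =
        (u * ladderNum u b c d n - B * normEDS b c d n ^ 2) ^ 2 := by
  have e := normEDS_invariant hd hn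
  have s := normEDS_somos_four (c := c) (d := d) hb (n := n) (by omega)
  simp only [ladderNum, show n + 1 + 1 = n + 2 by ring, show n + 1 - 1 = n by ring,
    show n - 1 + 1 = n by ring, show n - 1 - 1 = n - 2 by ring]
  set W := normEDS b c d
  refine ⟨by ring, ?_, ?_⟩
  · linear_combination -W n * e + W n ^ 4 * hb2
  · linear_combination -u * W n * e + W n ^ 2 * s + u * W n ^ 4 * hb2
      + W n ^ 2 * (W (n + 1) * W (n - 1)) * hb2 - W n ^ 4 * hc

end Ladder

/-- A nonzero linear form can be cancelled from a product of two linear forms. -/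
lemma linearForm_cancel {R : Type*} [CommRing R] [IsDomain R] {p q p' q' s t : R}
    (h : s ≠ 0 ∨ t ≠ 0) (h0 : p * s = p' * s) (h1 : p * t + q * s = p' * t + q' * s)
    (h2 : q * t = q' * t) : p = p' ∧ q = q' := by
  rcases h with h | h
  · obtain rfl := mul_right_cancel₀ h h0
    exact ⟨rfl, mul_right_cancel₀ h (add_left_cancel h1)⟩
  · obtain rfl := mul_right_cancel₀ h h2
    exact ⟨mul_right_cancel₀ h (add_right_cancel h1), rfl⟩

/-! ### Addition on the complete Edwards curve -/

/-- Two nonzero vectors of length three with equal cross products are proportional. -/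
lemma exists_scalar_of_cross {F : Type*} [Field F] {p q r p' q' r' : F}
    (h : p ≠ 0 ∨ q ≠ 0 ∨ r ≠ 0) (h' : p' ≠ 0 ∨ q' ≠ 0 ∨ r' ≠ 0) (e₁ : p * q' = q * p')
    (e₂ : p * r' = r * p') (e₃ : q * r' = r * q') :
    ∃ l : F, l ≠ 0 ∧ p = l * p' ∧ q = l * q' ∧ r = l * r' := by
  obtain ⟨l, h1, h2, h3⟩ : ∃ l : F, p = l * p' ∧ q = l * q' ∧ r = l * r' := by
    rcases h' with h' | h' | h'
    · exact ⟨p / p', by field_simp, by field_simp; grind, by field_simp; grind⟩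
    · exact ⟨q / q', by field_simp; grind, by field_simp, by field_simp; grind⟩
    · exact ⟨r / r', by field_simp; grind, by field_simp; grind, by field_simp⟩
  refine ⟨l, ?_, h1, h2, h3⟩
  rintro rfl
  simp_all

namespace TwistedEdwards

namespace Coords

variable {F : Type*} [Field F]

lemma add_eq_or (a d : F) (P Q : Coords F) :
    add a d P Q = addEdwards a d P Q ∨ add a d P Q = addDual a P Q := by
  unfold add
  split_ifs <;> simp

lemma onCompleteCurve_ofAffine {a d x y : F} (h : OnCurve a d x y) :
    (ofAffine x y).OnCompleteCurve a d := by
  unfold OnCurve at h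
  refine ⟨by simp [Nondegenerate, ofAffine], ?_⟩
  simp only [ofAffine]
  linear_combination h

lemma onCompleteCurve_nsmul {a d : F} (h2 : (2 : F) ≠ 0) (ha : a ≠ 0) (hd : d ≠ 0) (had : a ≠ d)
    {P : Coords F} (hP : P.OnCompleteCurve a d) (n : ℕ) :
    (nsmul a d n P).OnCompleteCurve a d := by
  induction n with
  | zero => exact onCompleteCurve_ofAffine (by simp [OnCurve])
  | succ n ih => exact add_onCompleteCurve h2 ha hd had ih hP

/-- On the complete curve the identity is the only point with `y = 1`. -/
lemma samePoint_zero_iff {a d : F} (had : a ≠ d) {P : Coords F} (hP : P.OnCompleteCurve a d) :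
    SamePoint P zero ↔ P.Y = P.T := by
  obtain ⟨⟨hXZ, hYT⟩, h⟩ := hP
  constructor
  · rintro ⟨-, c, hc, hY, hT⟩
    exact mul_left_cancel₀ hc (hY.symm.trans hT)
  · intro e
    have hT : P.T ≠ 0 := by simpa [e] using hYT
    have hX : P.X = 0 := by
      have : (a - d) * (P.X ^ 2 * P.T ^ 2) = 0 := by
        rw [e] at h
        linear_combination h
      simpa [sub_ne_zero.2 had, hT] using this
    have hZ : P.Z ≠ 0 := by simpa [hX] using hXZ
    refine ⟨⟨P.Z⁻¹, inv_ne_zero hZ, ?_, ?_⟩, P.T⁻¹, inv_ne_zero hT, ?_, ?_⟩ <;>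
      simp [zero, ofAffine, hX, hZ, hT, e]

/-- The `y`-coordinate of `(Q + P) - P` is that of `Q`, whichever of the two rules computes the two
sums. -/
lemma Y_add_neg_mul_T {a d x y : F} (hP : OnCurve a d x y) {Q : Coords F}
    (hQ : Q.OnCompleteCurve a d) :
    (add a d (add a d Q (ofAffine x y)) (ofAffine (-x) y)).Y * Q.T =
      Q.Y * (add a d (add a d Q (ofAffine x y)) (ofAffine (-x) y)).T := by
  have h' := hQ.2
  unfold OnCurve at hP
  generalize hR : add a d Q (ofAffine x y) = R
  generalize hS : add a d R (ofAffine (-x) y) = S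
  obtain ⟨X, Z, Y, T⟩ := Q
  rcases add_eq_or a d ⟨X, Z, Y, T⟩ (ofAffine x y) with h | h <;> rw [h] at hR <;>
    rcases add_eq_or a d R (ofAffine (-x) y) with h | h <;> rw [h] at hS <;> subst hR hS <;>
    simp only [addEdwards, addDual, ofAffine] at h' ⊢ <;> clear * - hP h' <;> grind

/-- The symmetric functions of the `y`-coordinates of `Q + P` and `Q - P` are biquadratic forms in
the `y`-coordinates of `P` and `Q`. -/
lemma cross_add_add_neg {a d x y : F} (hP : OnCurve a d x y) {Q R S : Coords F}
    (hQ : Q.OnCompleteCurve a d) (hR : R = add a d Q (ofAffine x y))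
    (hS : S = add a d Q (ofAffine (-x) y)) :
    R.T * S.T * (2 * (a - d) * y * Q.Y * Q.T) = (R.Y * S.T + R.T * S.Y) *
        (a * Q.T ^ 2 + d * Q.Y ^ 2 * y ^ 2 - d * (Q.Y ^ 2 + Q.T ^ 2 * y ^ 2)) ∧
      R.T * S.T * (a * (Q.Y ^ 2 + Q.T ^ 2 * y ^ 2) - a * Q.T ^ 2 - d * Q.Y ^ 2 * y ^ 2) =
        R.Y * S.Y * (a * Q.T ^ 2 + d * Q.Y ^ 2 * y ^ 2 - d * (Q.Y ^ 2 + Q.T ^ 2 * y ^ 2)) ∧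
      (R.Y * S.T + R.T * S.Y) *
          (a * (Q.Y ^ 2 + Q.T ^ 2 * y ^ 2) - a * Q.T ^ 2 - d * Q.Y ^ 2 * y ^ 2) =
        R.Y * S.Y * (2 * (a - d) * y * Q.Y * Q.T) := by
  have h' := hQ.2
  unfold OnCurve at hP
  obtain ⟨X, Z, Y, T⟩ := Q
  rcases add_eq_or a d ⟨X, Z, Y, T⟩ (ofAffine x y) with h | h <;> rw [h] at hR <;>
    rcases add_eq_or a d ⟨X, Z, Y, T⟩ (ofAffine (-x) y) with h | h <;> rw [h] at hS <;>
    subst hR hS <;> simp only [addEdwards, addDual, ofAffine] at h' ⊢ <;> clear * - hP h' <;>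
    refine ⟨?_, ?_, ?_⟩ <;> grind

/-- The relation between the `y`-coordinates of the consecutive points `S`, `Q = S + P` and
`R = Q + P`. -/
lemma exists_scalar_consecutive {a d x y : F} (h2 : (2 : F) ≠ 0) (ha : a ≠ 0) (hd : d ≠ 0)
    (had : a ≠ d) (hP : OnCurve a d x y) {S Q R : Coords F} (hS : S.OnCompleteCurve a d)
    (hQ : Q = add a d S (ofAffine x y)) (hR : R = add a d Q (ofAffine x y)) :
    ∃ l : F, l ≠ 0 ∧
      R.T * S.T =
        l * (a * Q.T ^ 2 + d * Q.Y ^ 2 * y ^ 2 - d * (Q.Y ^ 2 + Q.T ^ 2 * y ^ 2)) ∧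
      R.Y * S.T + R.T * S.Y = l * (2 * (a - d) * y * Q.Y * Q.T) ∧
      R.Y * S.Y =
        l * (a * (Q.Y ^ 2 + Q.T ^ 2 * y ^ 2) - a * Q.T ^ 2 - d * Q.Y ^ 2 * y ^ 2) := by
  have hPc := onCompleteCurve_ofAffine hP
  have hP' : OnCurve a d (-x) y := by simpa [OnCurve] using hP
  have hQc : Q.OnCompleteCurve a d := hQ ▸ add_onCompleteCurve h2 ha hd had hS hPc
  have hRc : R.OnCompleteCurve a d := hR ▸ add_onCompleteCurve h2 ha hd had hQc hPc
  obtain ⟨S', hS'⟩ : ∃ S', S' = add a d Q (ofAffine (-x) y) := ⟨_, rfl⟩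
  have hSc' : S'.OnCompleteCurve a d :=
    hS' ▸ add_onCompleteCurve h2 ha hd had hQc (onCompleteCurve_ofAffine hP')
  have hSS : S'.Y * S.T = S.Y * S'.T := by
    rw [hS', hQ]
    exact Y_add_neg_mul_T hP hS
  obtain ⟨m, hm, hY, hT⟩ := exists_scalar hSc'.1.2 hS.1.2 hSS
  obtain ⟨c1, c2, c3⟩ := cross_add_add_neg hP hQc hR hS'
  obtain ⟨l, hl, l0, l1, l2⟩ := exists_scalar_of_cross
    (by have := hSc'.1.2; have := hRc.1.2; grind)
    (by
      -- the sum of the outer entries is `(a - d) * (Q.Y ^ 2 + Q.T ^ 2 * y ^ 2)`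
      by_contra! h
      obtain ⟨h0, h1, h3⟩ := h
      have := hQc.1.2
      have := sub_ne_zero.2 had
      have e1 : Q.Y ^ 2 + Q.T ^ 2 * y ^ 2 = 0 := by grind
      have e2 : y * Q.Y * Q.T = 0 := by grind
      grind) c1 c2 c3
  refine ⟨m * l, mul_ne_zero hm hl, ?_, ?_, ?_⟩ <;> simp only [hY, hT]
  · linear_combination m * l0
  · linear_combination m * l1
  · linear_combination m * l2

end Coords

/-! ### Comparison of `psi` with the multiples of a point -/

section psi

variable {F : Type*} [Field F] {a d x y : F}

/-- The sequence `psi` is a normalised elliptic divisibility sequence. -/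
lemma psi_eq_normEDS (h : psi a d x y 2 ≠ 0) (n : ℕ) :
    psi a d x y n =
      normEDS (psi a d x y 2) (psi a d x y 3) (psi a d x y 4 / psi a d x y 2) n := by
  induction n using Nat.strong_induction_on with
  | _ n ih =>
    obtain hn | hn : n ≤ 4 ∨ 5 ≤ n := by omega
    · interval_cases n
      · simp [psi, -normEDS_ofNat]
      · simp [psi, -normEDS_ofNat]
      · exact (normEDS_two ..).symm
      · exact (normEDS_three ..).symm
      · refine Eq.trans ?_ (normEDS_four ..).symm
        field_simp
    obtain ⟨m, rfl | rfl⟩ := n.even_or_odd'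
    · rw [psi_even a d x y m (by omega), ih m (by omega), ih (m + 2) (by omega),
        ih (m - 1) (by omega), ih (m - 2) (by omega), ih (m + 1) (by omega)]
      have := normEDS_even (psi a d x y 2) (psi a d x y 3) (psi a d x y 4 / psi a d x y 2) m
      push_cast [show 1 ≤ m by omega, show 2 ≤ m by omega]
      rw [div_mul_eq_mul_div, div_eq_iff h, this]
      ring
    · rw [psi_odd a d x y m (by omega), ih m (by omega), ih (m + 2) (by omega),
        ih (m - 1) (by omega), ih (m + 1) (by omega)]
      push_cast [show 1 ≤ m by omega]
      rw [normEDS_odd]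

/-- With `u = (a - d)(1 + y) / (4(1 - y))`, the curve becomes the Weierstrass curve
`v² = u³ + A u² + B u`, where `A = (a + d) / 2` and `B = (a - d)² / 16`, and `psi` has the initial
values `2v`, `ψ₃` and `ψ₄` of the division polynomials of that curve. -/
lemma psi_weierstrass (h2 : (2 : F) ≠ 0) (had : a ≠ d) (hP : OnCurve a d x y) (hx : x ≠ 0)
    (hy : 1 - y ≠ 0) (h : psi a d x y 2 ≠ 0) {u A B : F}
    (hu : u = (a - d) * (1 + y) / (4 * (1 - y))) (hA : A = (a + d) / 2)
    (hB : B = (a - d) ^ 2 / 16) :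
    psi a d x y 2 ^ 2 = 4 * (u ^ 3 + A * u ^ 2 + B * u) ∧
      psi a d x y 3 = 3 * u ^ 4 + 4 * A * u ^ 3 + 6 * B * u ^ 2 - B ^ 2 ∧
      psi a d x y 4 / psi a d x y 2 + psi a d x y 2 ^ 4 =
        (6 * u ^ 2 + 4 * A * u + 2 * B) * psi a d x y 3 := by
  unfold OnCurve at hP
  have h4 : (4 : F) ≠ 0 := by
    rw [show (4 : F) = 2 * 2 by norm_num]
    exact mul_ne_zero h2 h2
  have h16 : (16 : F) ≠ 0 := by
    rw [show (16 : F) = 4 * 4 by norm_num]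
    exact mul_ne_zero h4 h4
  have hsq : psi a d x y 2 ^ 2 = 4 * (u ^ 3 + A * u ^ 2 + B * u) := by
    rw [psi_two, hu, hA, hB]
    have e : x ^ 2 * (a - d * y ^ 2) = (1 - y) * (1 + y) := by linear_combination hP
    field_simp
    linear_combination -256 * (1 + y) * e
  have h3 : psi a d x y 3 = 3 * u ^ 4 + 4 * A * u ^ 3 + 6 * B * u ^ 2 - B ^ 2 := by
    rw [psi, hu, hA, hB]
    field_simp
    ring
  refine ⟨hsq, h3, ?_⟩
  have hdiv : psi a d x y 4 / psi a d x y 2 =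
      2 * (a - d) ^ 5 * y * (a - d * y ^ 4) / (2 * (1 - y)) ^ 6 := by
    rw [div_eq_iff h, psi_two, psi]
    field_simp
  rw [hdiv, h3, show psi a d x y 2 ^ 4 = (psi a d x y 2 ^ 2) ^ 2 by ring, hsq, hu, hA, hB]
  field_simp
  ring

open Coords in
/-- The `x`-coordinate of `[n]P` on the Weierstrass curve is `Φₙ / ψₙ²`, as an equality of points of
`ℙ¹`: by `ladderNum_relations` and `Coords.exists_scalar_consecutive`, both sides satisfy the same
relation between three consecutive multiples, in which the term of index `n` cancels. -/
lemma exists_scalar_nsmul (h2 : (2 : F) ≠ 0) (ha : a ≠ 0) (hd : d ≠ 0) (had : a ≠ d)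
    (hP : OnCurve a d x y) (hy : 1 - y ≠ 0) {u A B b c D : F}
    (hu : u = (a - d) * (1 + y) / (4 * (1 - y))) (hA : A = (a + d) / 2)
    (hB : B = (a - d) ^ 2 / 16) (hb : b ≠ 0) (hb2 : b ^ 2 = 4 * (u ^ 3 + A * u ^ 2 + B * u))
    (hc : c = 3 * u ^ 4 + 4 * A * u ^ 3 + 6 * B * u ^ 2 - B ^ 2)
    (hD : D + b ^ 4 = (6 * u ^ 2 + 4 * A * u + 2 * B) * c) (n : ℕ) :
    ∃ l : F, l ≠ 0 ∧
      ladderNum u b c D n =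
        l * ((a - d) * ((nsmul a d n (ofAffine x y)).T + (nsmul a d n (ofAffine x y)).Y)) ∧
      normEDS b c D n ^ 2 =
        l * (4 * ((nsmul a d n (ofAffine x y)).T - (nsmul a d n (ofAffine x y)).Y)) := by
  have had' := sub_ne_zero.2 had
  have h4 : (4 : F) ≠ 0 := by
    rw [show (4 : F) = 2 * 2 by norm_num]
    exact mul_ne_zero h2 h2
  have h16 : (16 : F) ≠ 0 := by
    rw [show (16 : F) = 4 * 4 by norm_num]
    exact mul_ne_zero h4 h4
  induction n using Nat.twoStepInduction with
  | zero =>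
    refine ⟨(2 * (a - d))⁻¹, inv_ne_zero (mul_ne_zero h2 had'), ?_, ?_⟩
    · simp [ladderNum, nsmul, zero, ofAffine, normEDS_neg]
      field_simp
      norm_num
    · simp [nsmul, zero, ofAffine]
  | one =>
    refine ⟨(4 * (1 - y))⁻¹, inv_ne_zero (mul_ne_zero h4 hy), ?_, ?_⟩
    · simp [ladderNum, nsmul, add, zero, ofAffine, addEdwards, Nondegenerate, hu]
      field_simp
    · simp [nsmul, add, zero, ofAffine, addEdwards, Nondegenerate]
      field_simp
  | more n ih0 ih1 =>
    obtain ⟨k, hk, k0, k1⟩ := ih0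
    obtain ⟨m, hm, m0, m1⟩ := ih1
    have hS := onCompleteCurve_nsmul h2 ha hd had (onCompleteCurve_ofAffine hP) n
    obtain ⟨l, hl, l0, l1, l2⟩ := exists_scalar_consecutive h2 ha hd had hP hS
      (Q := nsmul a d (n + 1) (ofAffine x y)) rfl (R := nsmul a d (n + 2) (ofAffine x y)) rfl
    obtain ⟨r0, r1, r2⟩ := ladderNum_relations hb hb2 hc hD (n := n + 1) (by omega)
    push_cast at m0 m1 ⊢
    rw [add_sub_cancel_right, add_assoc, show (1 : ℤ) + 1 = 2 by norm_num] at r0 r1 r2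
    rw [m0, m1] at r1 r2
    rw [m0, m1] at r0
    generalize nsmul a d n (ofAffine x y) = S at *
    generalize nsmul a d (n + 1) (ofAffine x y) = Q at *
    generalize nsmul a d (n + 2) (ofAffine x y) = R at *
    have hST : ladderNum u b c D n ≠ 0 ∨ normEDS b c D n ^ 2 ≠ 0 := by
      by_contra! h
      have e1 : S.T + S.Y = 0 := by simpa [h.1, hk, had'] using k0.symm
      have e2 : S.T - S.Y = 0 := by
        rw [h.2] at k1
        simpa [hk, h4] using k1.symm
      have e3 : S.Y = 0 := (mul_eq_zero.1 (by linear_combination e1 - e2)).resolve_left h2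
      have e4 : S.T = 0 := by simpa [e3] using e1
      exact hS.1.2.elim (· e3) (· e4)
    -- the quotient of the two biquadratic relations gives the scalar
    refine ⟨m ^ 2 * (a - d) / (4 * l * k * (1 - y) ^ 2), ?_,
      linearForm_cancel hST ?_ ?_ ?_⟩
    · simp [hm, had', hl, hk, hy, h4]
    · rw [r2, k0, hu, hB]
      field_simp
      linear_combination -1024 * (l0 + l1 + l2)
    · rw [r1, k0, k1, hu, hA, hB]
      field_simp
      linear_combination -256 * (l0 - l2)
    · rw [r0, k1, hu]
      field_simp
      linear_combination -4 * (l0 - l1 + l2)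

end psi

end TwistedEdwards

theorem corollary5p2 {k : Type*} [Field k] (h2 : ringChar k ≠ 2) (h3 : ringChar k ≠ 3)
    {K : Type*} [Field K] [Algebra k K] [IsAlgClosure k K]
    (a d : k) (ha : a ≠ 0) (hd : d ≠ 0) (had : a ≠ d) (x y : K)
    (hP : TwistedEdwards.OnCurve (algebraMap k K a) (algebraMap k K d) x y)
    (hP₁ : (x, y) ≠ (0, 1)) (hP₂ : (x, y) ≠ (0, -1)) (n : ℕ) (hn : 1 ≤ n) :
    TwistedEdwards.IsTorsionPoint (algebraMap k K a) (algebraMap k K d) x y n ↔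
      TwistedEdwards.psi (algebraMap k K a) (algebraMap k K d) x y n = 0 := by
  have h2' : (2 : K) ≠ 0 := by
    rw [← map_ofNat (algebraMap k K) 2]
    exact (map_ne_zero _).2 (Ring.two_ne_zero h2)
  have inj := (algebraMap k K).injective
  have ha' : algebraMap k K a ≠ 0 := (map_ne_zero _).2 ha
  have hd' : algebraMap k K d ≠ 0 := (map_ne_zero _).2 hd
  have had' : algebraMap k K a ≠ algebraMap k K d := inj.ne had
  generalize algebraMap k K a = a at *
  generalize algebraMap k K d = d at *
  obtain ⟨hx, hy, hb⟩ := TwistedEdwards.denominators_ne_zero h2' had' hP hP₁ hP₂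
  have hy' : 1 - y ≠ 0 := right_ne_zero_of_mul hy
  obtain ⟨hb2, hc, hD⟩ := TwistedEdwards.psi_weierstrass h2' had' hP hx hy' hb rfl rfl rfl
  obtain ⟨l, hl, -, e⟩ := TwistedEdwards.exists_scalar_nsmul h2' ha' hd' had' hP hy' rfl rfl rfl
    hb hb2 hc hD n
  have h4 : (4 : K) ≠ 0 := by
    rw [show (4 : K) = 2 * 2 by norm_num]
    exact mul_ne_zero h2' h2'
  rw [TwistedEdwards.IsTorsionPoint, TwistedEdwards.Coords.samePoint_zero_iff had'
    (TwistedEdwards.Coords.onCompleteCurve_nsmul h2' ha' hd' had'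
      (TwistedEdwards.Coords.onCompleteCurve_ofAffine hP) n),
    TwistedEdwards.psi_eq_normEDS hb, ← pow_eq_zero_iff two_ne_zero, e]
  simp [hl, h4, sub_eq_zero, eq_comm (a := TwistedEdwards.Coords.Y _)]
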